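/- Let $0<r<n$, let $\alpha,\beta\in\mathbb{C}$, let $C$ be an $r\times(n-r)$ and $D$ an $(n-r)\times r$ complex matrix, and let $$A=\begin{bmatrix}\alpha I_r & C\\ D & \beta I_{n-r}\end{bmatrix}.$$ For $1\le k\le n$ let $\Lambda_k(A)$ be the rank-$k$ numerical range of $A$, that is, the set of all $\lambda\in\mathbb{C}$ such that $PAP=\lambda P$ for some orthogonal projection $P\in M_n(\mathbb{C})$ of rank $k$. Suppose that $DC=z_1I_{n-r}$ for some $z_1\in\mathbb{C}$, and let $h_1\ge\dots\ge h_{n-r}$ be the eigenvalues, counting multiplicities, of $C^*C+DD^*$. Put $\Delta=(\alpha-\beta)^2+4z_1$, and for $1\le k\le n-r$ let $\mathcal{E}^1_k$ be the closed elliptical disc (possibly degenerate to a line segment or a point) with foci at $\tfrac12(\alpha+\beta)\pm\tfrac12\sqrt{\Delta}$ and with major and minor axes of lengths $$\sqrt{\tfrac12|\alpha-\beta|^2+h_k+\tfrac12|\Delta|}\qquad\text{and}\qquad\sqrt{\tfrac12|\alpha-\beta|^2+h_k-\tfrac12|\Delta|},$$ respectively. If $n<2r$, then $\Lambda_k(A)=\mathcal{E}^1_k$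 for $1\le k\le n-r$; $\Lambda_k(A)=\{\alpha\}$ for $n-r<k\le r$; and $\Lambda_k(A)=\emptyset$ for every $r<k\le n$ such that $\alpha\ne\beta$ or $h_{n-k+1}\neq 0$. If $n=2r$, then $\Lambda_k(A)=\mathcal{E}^1_k$ for $1\le k\le n/2$, and $\Lambda_k(A)=\emptyset$ for every $n/2<k\le n$ such that $\alpha\ne\beta$ or $h_{n-k+1}\neq 0$. -/

import Mathlib

/-- The rank-`k` numerical range of a square complex matrix `A`: the set of all `μ : ℂ` such that
`P A P = μ P` for some orthogonal projection `P` (Hermitian and idempotent) of rank `k`. -/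
def higherRankNumericalRange {ι : Type*} [Fintype ι] [DecidableEq ι]
    (k : ℕ) (A : Matrix ι ι ℂ) : Set ℂ :=
  {μ : ℂ | ∃ P : Matrix ι ι ℂ,
    P.IsHermitian ∧ P * P = P ∧ P.rank = k ∧ P * A * P = μ • P}

/-- `S` is the closed elliptical disc with foci `f₁`, `f₂`, whose major and minor axes have
(full) lengths `a` and `b`: the set of points whose distances to the foci add up to at most `a`,
where the lengths satisfy the relation `a² = b² + |f₁ - f₂|²`.
The minor axis may have length zero (`S` is then the segment joining the foci), and so may
both axes (`S` is then a point). -/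
def IsEllipticalDisc (S : Set ℂ) (f₁ f₂ : ℂ) (a b : ℝ) : Prop :=
  0 ≤ a ∧ 0 ≤ b ∧ a ^ 2 = b ^ 2 + ‖f₁ - f₂‖ ^ 2 ∧ S = {z : ℂ | ‖z - f₁‖ + ‖z - f₂‖ ≤ a}

/-! A point `μ` belongs to the rank-`k` range iff the sesquilinear form of `A - μ` vanishes on some
`k`-dimensional subspace. Write a = α - μ, b = β - μ, z = z₁. A unitary change of basis in the
second block makes C*C + DD* diagonal and keeps DC = z scalar. For k ≤ min(r, n - r), membership is
then equivalent to 2 Re(a b̄) + 2|ab - z| ≤ h_k. Since the foci are the roots μ of ab = z, this is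
the squared focal inequality of the ellipse (`norm_sub_add_norm_sub_le_sqrt_iff`).

Sufficiency (`exists_quadratic_solution`): an isotropic graph subspace is a solution S of aS*S + b +
S*C + DS = 0. Because DC is scalar, C + D* and C - D* have diagonal Gram matrices, and the equation
decouples into scalar ones.

Necessity (`le_of_mem_higherRankNumericalRange`): for |e| = 1 the Hermitian part of e(A - μ) is
governed by eC + ēD*, with Gram matrix C*C + DD* + 2 Re(e²z). If the inequality fails, some e makes
this part negative definite on a subspace of codimension k - 1, which meets every k-dimensional
subspace. Similar dimension counts give the singleton and empty cases. -/

open Matrix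

/-! ### Higher-rank numerical ranges and isotropic subspaces. -/

open scoped ComplexOrder in
/-- `μ` lies in the rank-`k` numerical range iff some `k`-dimensional subspace is totally isotropic
for `A - μ`. -/
theorem mem_higherRankNumericalRange_iff {ι : Type*} [Fintype ι] [DecidableEq ι] (k : ℕ)
    (A : Matrix ι ι ℂ) (μ : ℂ) :
    μ ∈ higherRankNumericalRange k A ↔
      ∃ X : Matrix ι (Fin k) ℂ, Function.Injective X.mulVec ∧ Xᴴ * (A - μ • 1) * X = 0 := by
  constructor
  · rintro ⟨P, hP, hPP, hk, hPA⟩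
    have hfr : Module.finrank ℂ (LinearMap.range P.mulVecLin) = k := hk
    obtain ⟨b⟩ : Nonempty (Module.Basis (Fin k) ℂ (LinearMap.range P.mulVecLin)) :=
      ⟨Module.finBasisOfFinrankEq ℂ _ hfr⟩
    obtain ⟨X, hcol⟩ : ∃ X : Matrix ι (Fin k) ℂ, ∀ j, X.col j = (b j : ι → ℂ) :=
      ⟨of fun i j => (b j : ι → ℂ) i, fun _ => rfl⟩
    have hPX : P * X = X := by
      ext i j
      obtain ⟨w, hw⟩ := (b j).2
      have h1 : P *ᵥ X.col j = X.col j := by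
        rw [hcol, ← hw, mulVecLin_apply, mulVec_mulVec, hPP]
      exact congrFun h1 i
    refine ⟨X, ?_, ?_⟩
    · rw [mulVec_injective_iff, funext hcol]
      exact LinearIndependent.map' b.linearIndependent (LinearMap.range P.mulVecLin).subtype
        (Submodule.ker_subtype _)
    · have hXP : Xᴴ * P = Xᴴ := by
        rw [← hP.eq, ← conjTranspose_mul, hPX]
      have h0 : P * (A - μ • 1) * P = 0 := by
        rw [mul_sub, sub_mul, hPA]; simp [hPP]
      calc Xᴴ * (A - μ • 1) * X = (Xᴴ * P) * (A - μ • 1) * (P * X) := by rw [hXP, hPX]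
        _ = Xᴴ * (P * (A - μ • 1) * P) * X := by simp only [Matrix.mul_assoc]
        _ = 0 := by rw [h0]; simp
  · rintro ⟨X, hX, h0⟩
    have hpd := PosDef.conjTranspose_mul_self X hX
    set G := Xᴴ * X with hG
    have hdet : IsUnit G.det := (isUnit_iff_isUnit_det G).1 hpd.isUnit
    have hGG : G⁻¹ * G = 1 := nonsing_inv_mul G hdet
    have hGi : (G⁻¹)ᴴ = G⁻¹ := by rw [conjTranspose_nonsing_inv, hpd.1.eq]
    have hXA : Xᴴ * A * X = μ • G := by
      have : Xᴴ * (A - μ • 1) * X = Xᴴ * A * X - μ • G := by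
        rw [Matrix.mul_sub, Matrix.sub_mul]; simp [hG]
      rwa [this, sub_eq_zero] at h0
    have hPX : X * G⁻¹ * Xᴴ * X = X := by
      rw [Matrix.mul_assoc (X * G⁻¹), ← hG, Matrix.mul_assoc, hGG, Matrix.mul_one]
    have hrX : X.rank = k := by
      have := LinearMap.finrank_range_of_inj (f := X.mulVecLin) hX
      rw [Module.finrank_fin_fun] at this
      exact this
    -- The orthogonal projection onto the column space of `X`.
    refine ⟨X * G⁻¹ * Xᴴ, ?_, ?_, ?_, ?_⟩
    · simp only [IsHermitian, conjTranspose_mul, conjTranspose_conjTranspose, hGi, Matrix.mul_assoc]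
    · rw [← Matrix.mul_assoc, ← Matrix.mul_assoc, hPX]
    · apply le_antisymm
      · rw [Matrix.mul_assoc]
        exact (rank_mul_le_left _ _).trans hrX.le
      · conv_lhs => rw [← hrX, ← hPX]
        exact rank_mul_le_left _ _
    · calc X * G⁻¹ * Xᴴ * A * (X * G⁻¹ * Xᴴ) = X * G⁻¹ * (Xᴴ * A * X) * G⁻¹ * Xᴴ := by
            simp only [Matrix.mul_assoc]
        _ = μ • (X * (G⁻¹ * G) * G⁻¹ * Xᴴ) := by
            rw [hXA]; simp only [Matrix.mul_assoc, Matrix.mul_smul, Matrix.smul_mul]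
        _ = _ := by rw [hGG, Matrix.mul_one]

/-- The rank-`k` numerical range is invariant under unitary similarity. -/
theorem higherRankNumericalRange_conj {ι : Type*} [Fintype ι] [DecidableEq ι] (k : ℕ)
    (A W : Matrix ι ι ℂ) (hW : Wᴴ * W = 1) :
    higherRankNumericalRange k (Wᴴ * A * W) = higherRankNumericalRange k A := by
  have hW' : W * Wᴴ = 1 := mul_eq_one_comm.1 hW
  have hinj : ∀ V : Matrix ι ι ℂ, ∀ V' : Matrix ι ι ℂ, V' * V = 1 →
      Function.Injective V.mulVec := fun V V' h =>
    Function.LeftInverse.injective (g := V'.mulVec) fun v => by simp [h]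
  ext μ
  have key : Wᴴ * A * W - μ • 1 = Wᴴ * (A - μ • 1) * W := by
    rw [Matrix.mul_sub, Matrix.sub_mul]; simp [hW]
  simp only [mem_higherRankNumericalRange_iff, key]
  constructor
  · rintro ⟨X, hX, h0⟩
    refine ⟨W * X, ?_, ?_⟩
    · have : (W * X).mulVec = W.mulVec ∘ X.mulVec := by ext v; simp
      rw [this]
      exact (hinj W _ hW).comp hX
    · rw [← h0, conjTranspose_mul]; simp only [Matrix.mul_assoc]
  · rintro ⟨X, hX, h0⟩
    refine ⟨Wᴴ * X, ?_, ?_⟩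
    · have : (Wᴴ * X).mulVec = Wᴴ.mulVec ∘ X.mulVec := by ext v; simp
      rw [this]
      exact (hinj Wᴴ _ hW').comp hX
    · calc (Wᴴ * X)ᴴ * (Wᴴ * (A - μ • 1) * W) * (Wᴴ * X)
          = Xᴴ * (W * Wᴴ) * (A - μ • 1) * (W * Wᴴ) * X := by
            rw [conjTranspose_mul, conjTranspose_conjTranspose]; simp only [Matrix.mul_assoc]
        _ = 0 := by rw [hW']; simpa using h0

/-- An isotropic subspace of dimension `k` contains a nonzero isotropic vector satisfying any
prescribed system of fewer than `k` linear equations. -/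
theorem exists_isotropic_vector {ι J : Type*} [Fintype ι] [Fintype J] {k : ℕ}
    (B : Matrix ι ι ℂ) (X : Matrix ι (Fin k) ℂ) (hX : Function.Injective X.mulVec)
    (h0 : Xᴴ * B * X = 0) (F : (ι → ℂ) →ₗ[ℂ] (J → ℂ)) (hJ : Fintype.card J < k) :
    ∃ v : ι → ℂ, v ≠ 0 ∧ F v = 0 ∧ star v ⬝ᵥ B *ᵥ v = 0 := by
  have hker : LinearMap.ker (F ∘ₗ X.mulVecLin) ≠ ⊥ := by
    apply LinearMap.ker_ne_bot_of_finrank_lt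
    simpa using hJ
  obtain ⟨x, hx, hx0⟩ := Submodule.exists_mem_ne_zero_of_ne_bot hker
  refine ⟨X *ᵥ x, fun h => hx0 (hX (by simpa using h)), by simpa using hx, ?_⟩
  rw [star_mulVec, ← dotProduct_mulVec, mulVec_mulVec, mulVec_mulVec, h0]
  simp

/-! ### Ordered diagonalisation and factorisation through an isometry. -/

/-- A Hermitian matrix whose eigenvalues are listed in decreasing order by `h` is unitarily
similar to the diagonal matrix with these entries, in this order. -/
theorem exists_unitary_diagonal_of_roots {m : ℕ} (H : Matrix (Fin m) (Fin m) ℂ)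
    (hH : H.IsHermitian) (h : ℕ → ℝ) (h_anti : AntitoneOn h (Set.Icc 1 m))
    (h_eig : H.charpoly.roots = (Finset.Icc 1 m).val.map (fun j => (h j : ℂ))) :
    ∃ U : Matrix (Fin m) (Fin m) ℂ, Uᴴ * U = 1 ∧
      Uᴴ * H * U = diagonal fun i : Fin m => (h (i + 1) : ℂ) := by
  have hIcc : (Finset.Icc 1 m).val.map h = (List.ofFn fun i : Fin m => h (i + 1) : Multiset ℝ) := by
    have h1 : Finset.Icc 1 m = Finset.univ.image fun i : Fin m => (i : ℕ) + 1 := by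
      ext j
      simp only [Finset.mem_Icc, Finset.mem_image, Finset.mem_univ, true_and]
      constructor
      · rintro ⟨h1, h2⟩
        exact ⟨⟨j - 1, by omega⟩, by simp; omega⟩
      · rintro ⟨i, rfl⟩
        have := i.2
        omega
    rw [h1, Finset.image_val_of_injOn (fun a _ b _ hab => by simpa [Fin.ext_iff] using hab),
      Multiset.map_map, Fin.univ_val_map]
    rfl
  -- Both lists are decreasing arrangements of the same multiset of roots.
  have hlist : List.ofFn hH.eigenvalues₀ = List.ofFn fun i : Fin m => h (i + 1) := by
    rw [← hH.sort_roots_charpoly_eq_eigenvalues₀, h_eig, Multiset.map_map]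
    have h2 : (RCLike.re ∘ fun j : ℕ => (h j : ℂ)) = h := by ext j; simp
    rw [h2, hIcc, Multiset.coe_sort]
    apply List.mergeSort_of_pairwise
    have h3 : Antitone fun i : Fin m => h (i + 1) := fun i j hij =>
      h_anti ⟨by omega, i.2⟩ ⟨by omega, j.2⟩ (by simpa using hij)
    simpa using h3.sortedGE_ofFn.pairwise
  have heig : ∀ i, hH.eigenvalues₀ i = h (i + 1) := by
    intro i
    have hi : (i : ℕ) < m := by simpa using i.2
    have := List.getElem_of_eq hlist (i := i) (by simpa using hi)
    simpa using this
  let σ : Fin (Fintype.card (Fin m)) ≃ Fin m := Fintype.equivOfCardEq (Fintype.card_fin _)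
  let τ : Fin m ≃ Fin m := (finCongr (Fintype.card_fin m).symm).trans σ
  have hτ : ∀ i, hH.eigenvalues (τ i) = h (i + 1) := by
    intro i
    have : hH.eigenvalues (τ i) = hH.eigenvalues₀ (σ.symm (τ i)) := rfl
    rw [this, heig]
    simp [τ]
  let V : Matrix (Fin m) (Fin m) ℂ := hH.eigenvectorUnitary
  have hV : Vᴴ * V = 1 := Unitary.coe_star_mul_self hH.eigenvectorUnitary
  have hHV : Vᴴ * H * V = diagonal fun i => (hH.eigenvalues i : ℂ) := by
    have := hH.conjStarAlgAut_star_eigenvectorUnitary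
    rw [Unitary.conjStarAlgAut_star_apply] at this
    exact this
  refine ⟨V.submatrix id τ, ?_, ?_⟩
  · rw [conjTranspose_submatrix, submatrix_mul _ _ _ id _ Function.bijective_id |>.symm, hV]
    exact submatrix_one_equiv τ
  · have h5 : (V.submatrix id τ)ᴴ * H * V.submatrix id τ = (Vᴴ * H * V).submatrix τ τ := by
      rw [submatrix_mul _ _ τ id τ Function.bijective_id, submatrix_mul _ _ τ id id
        Function.bijective_id, conjTranspose_submatrix, submatrix_id_id]
    rw [h5, hHV, submatrix_diagonal_equiv]
    congr 1
    ext i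
    simp [hτ]

/-- A matrix whose columns are pairwise orthogonal, with at least as many rows as columns, factors
through an isometry. -/
theorem exists_isometry_mul_diagonal {r k : ℕ} (hkr : k ≤ r) (L : Matrix (Fin r) (Fin k) ℂ)
    (M : Fin k → ℝ) (hL : Lᴴ * L = diagonal fun j => (M j : ℂ)) :
    (∀ j, 0 ≤ M j) ∧ ∃ V : Matrix (Fin r) (Fin k) ℂ, Vᴴ * V = 1 ∧
      L = V * diagonal fun j => (√(M j) : ℂ) := by
  have hdot : ∀ i j, star (L.col i) ⬝ᵥ L.col j = if i = j then (M i : ℂ) else 0 := by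
    intro i j
    have := congrFun (congrFun hL i) j
    rw [diagonal_apply] at this
    rw [← this]; rfl
  let w : Fin k → EuclideanSpace ℂ (Fin r) := fun j => WithLp.toLp 2 (L.col j)
  have hw : ∀ i j, inner ℂ (w i) (w j) = if i = j then (M i : ℂ) else 0 := by
    intro i j
    rw [← hdot, EuclideanSpace.inner_toLp_toLp, dotProduct_comm]
  have hnorm : ∀ j, ‖w j‖ ^ 2 = M j := by
    intro j
    have h1 := inner_self_eq_norm_sq_to_K (𝕜 := ℂ) (w j)
    rw [hw, if_pos rfl] at h1
    exact Complex.ofReal_injective (by simpa using h1.symm)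
  have hM : ∀ j, 0 ≤ M j := fun j => hnorm j ▸ sq_nonneg _
  have hnorm' : ∀ j, ‖w j‖ = √(M j) := fun j => by
    rw [← hnorm, Real.sqrt_sq (norm_nonneg _)]
  refine ⟨hM, ?_⟩
  -- Nonzero columns are normalised and extended to an orthonormal basis. At a zero column any basis
  -- vector serves, because it is multiplied by `√0`.
  let v : Fin r → EuclideanSpace ℂ (Fin r) := fun i =>
    if hi : (i : ℕ) < k then ((√(M ⟨i, hi⟩))⁻¹ : ℂ) • w ⟨i, hi⟩ else 0
  let s : Set (Fin r) := {i | ∃ hi : (i : ℕ) < k, M ⟨i, hi⟩ ≠ 0}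
  have hs : Orthonormal ℂ (s.domRestrict v) := by
    rw [orthonormal_iff_ite]
    rintro ⟨i, hi, hMi⟩ ⟨j, hj, hMj⟩
    have hsq : (√(M ⟨i, hi⟩) : ℂ) ≠ 0 := by
      exact_mod_cast Real.sqrt_ne_zero'.2 (lt_of_le_of_ne (hM _) hMi.symm)
    simp only [Set.domRestrict_apply, v, dif_pos hi, dif_pos hj, inner_smul_left, inner_smul_right,
      hw, Subtype.mk.injEq, Fin.ext_iff]
    split_ifs with hij
    · have hij' : i = j := Fin.ext hij
      subst hij'
      rw [map_inv₀, Complex.conj_ofReal]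
      field_simp
      rw [← Complex.ofReal_pow, Real.sq_sqrt (hM _)]
    · simp
  obtain ⟨b, hb⟩ := hs.exists_orthonormalBasis_extension_of_card_eq (by simp)
  let c : Fin k → Fin r := Fin.castLE hkr
  let V : Matrix (Fin r) (Fin k) ℂ := of fun i j => b (c j) i
  refine ⟨V, ?_, ?_⟩
  · ext i j
    have h1 : (Vᴴ * V) i j = inner ℂ (b (c i)) (b (c j)) := by
      simp [Matrix.mul_apply, V, PiLp.inner_apply, mul_comm]
    rw [h1, orthonormal_iff_ite.1 b.orthonormal, one_apply]
    simp [c, Fin.ext_iff]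
  · ext i j
    rw [mul_diagonal]
    by_cases hj : M j = 0
    · have h0 : w j = 0 := by
        rw [← norm_eq_zero, hnorm', hj, Real.sqrt_zero]
      have h1 : L i j = w j i := rfl
      rw [h1, h0, hj]; simp
    · have h1 := hb (c j) ⟨j.2, hj⟩
      have hsq : (√(M j) : ℂ) ≠ 0 := by
        exact_mod_cast Real.sqrt_ne_zero'.2 (lt_of_le_of_ne (hM _) (Ne.symm hj))
      have h2 : v (c j) = ((√(M j))⁻¹ : ℂ) • w j := by
        simp only [v, c, Fin.val_castLE, Fin.is_lt, dif_pos]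
      have h3 : V i j = ((√(M j))⁻¹ : ℂ) * L i j := by
        change b (c j) i = _
        rw [h1, h2]; rfl
      rw [h3]
      field_simp

/-! ### The quadratic matrix equation for isotropic graphs. -/

theorem exists_normSq_eq_and_sqrt_mul_im_eq {M R w : ℝ} (hM : 0 ≤ M) (hR : 0 ≤ R)
    (hw : w ^ 2 ≤ M * R) : ∃ ν : ℂ, star ν * ν = R ∧ √M * ν.im = w := by
  have hss : ∀ ν : ℂ, star ν * ν = ((ν.re ^ 2 + ν.im ^ 2 : ℝ) : ℂ) := fun ν => by
    rw [Complex.star_def, ← Complex.normSq_eq_conj_mul_self, Complex.normSq_apply]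
    congr 1; ring
  rcases hM.eq_or_lt with rfl | hM'
  · have : w = 0 := by nlinarith
    refine ⟨⟨√R, 0⟩, ?_, by simp [this]⟩
    rw [hss]; simp [Real.sq_sqrt hR]
  · have hs := Real.sqrt_pos.2 hM'
    have hq : (w / √M) ^ 2 = w ^ 2 / M := by rw [div_pow, Real.sq_sqrt hM]
    have hle : w ^ 2 / M ≤ R := by rw [div_le_iff₀ hM']; linarith
    refine ⟨⟨√(R - w ^ 2 / M), w / √M⟩, ?_, by field_simp⟩
    rw [hss, Real.sq_sqrt (sub_nonneg.2 hle), hq]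
    simp

/-- With K = C + D*, L = C - D*, completing the square by S = -K/(2a) + Q leaves only Q*Q, Q*L - L*Q
and diagonal terms. Factoring L = Vm and taking Q = VN with N = diag(ν) makes everything diagonal.
The Hermitian part then prescribes |ν_j|², the skew part prescribes √M_j · Im ν_j, where M_j = η_j -
2 Re z. -/
theorem exists_quadratic_solution_of_pos {r k : ℕ} (hkr : k ≤ r) (a : ℝ) (ha : 0 < a) (b z : ℂ)
    (C : Matrix (Fin r) (Fin k) ℂ) (D : Matrix (Fin k) (Fin r) ℂ) (hDC : D * C = z • 1)
    (η : Fin k → ℝ) (hη : Cᴴ * C + D * Dᴴ = diagonal fun j => (η j : ℂ))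
    (hineq : ∀ j, 2 * (a * star b).re + 2 * ‖a * b - z‖ ≤ η j) :
    ∃ S : Matrix (Fin r) (Fin k) ℂ,
      (a : ℂ) • (Sᴴ * S) + b • 1 + Sᴴ * C + D * S = 0 := by
  have hDC' : Cᴴ * Dᴴ = star z • 1 := by
    rw [← conjTranspose_mul, hDC, conjTranspose_smul, conjTranspose_one]
  have hηC : Cᴴ * C = (diagonal fun j => (η j : ℂ)) - D * Dᴴ := eq_sub_of_add_eq hη
  obtain ⟨K, hK⟩ : ∃ K, K = C + Dᴴ := ⟨_, rfl⟩
  obtain ⟨L, hL⟩ : ∃ L, L = C - Dᴴ := ⟨_, rfl⟩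
  have hLL : Lᴴ * L = diagonal fun j => ((η j - 2 * z.re : ℝ) : ℂ) := by
    have h1 : Lᴴ * L = Cᴴ * C + D * Dᴴ - D * C - Cᴴ * Dᴴ := by
      rw [hL, conjTranspose_sub, conjTranspose_conjTranspose]
      simp only [Matrix.mul_sub, Matrix.sub_mul]; abel
    rw [h1, hη, hDC, hDC']
    ext i j
    by_cases hij : i = j
    · subst hij
      apply Complex.ext <;> simp
      ring
    · simp [hij]
  obtain ⟨hM, V, hV, hLV⟩ := exists_isometry_mul_diagonal hkr L _ hLL
  have hνex : ∀ j, ∃ ν : ℂ, star ν * ν = (((η j + 2 * z.re) / (4 * a ^ 2) - b.re / a : ℝ) : ℂ) ∧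
      √(η j - 2 * z.re) * ν.im = b.im - z.im / a := by
    intro j
    have hj := hineq j
    have hre : (a * star b).re = a * b.re := by simp
    rw [hre] at hj
    have hnn : ‖(a : ℂ) * b - z‖ ^ 2 = (a * b.re - z.re) ^ 2 + (a * b.im - z.im) ^ 2 := by
      rw [← Complex.normSq_eq_norm_sq, Complex.normSq_apply]
      simp; ring
    have hn0 := norm_nonneg ((a : ℂ) * b - z)
    have hre' : a * b.re - z.re ≤ ‖(a : ℂ) * b - z‖ := by
      refine (le_abs_self _).trans (abs_le_of_sq_le_sq ?_ hn0)
      nlinarith [sq_nonneg (a * b.im - z.im)]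
    -- The solvability condition w² ≤ MR for ν is this inequality, because (η - 2 Re z)(η + 2 Re z -
    -- 4a Re b) = (η - 2a Re b)² - 4(a Re b - Re z)².
    have hsq : (2 * ‖(a : ℂ) * b - z‖) ^ 2 ≤ (η j - 2 * (a * b.re)) ^ 2 :=
      pow_le_pow_left₀ (by positivity) (by linarith) 2
    apply exists_normSq_eq_and_sqrt_mul_im_eq (hM j)
    · have : (η j + 2 * z.re) / (4 * a ^ 2) - b.re / a
          = (η j + 2 * z.re - 4 * (a * b.re)) / (4 * a ^ 2) := by field_simp
      rw [this]
      apply div_nonneg _ (by positivity)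
      linarith
    · have h1 : b.im - z.im / a = (a * b.im - z.im) / a := by field_simp
      have h2 : (η j - 2 * z.re) * ((η j + 2 * z.re) / (4 * a ^ 2) - b.re / a)
          = (η j - 2 * z.re) * (η j + 2 * z.re - 4 * (a * b.re)) / 4 / a ^ 2 := by field_simp
      rw [h1, h2, div_pow]
      gcongr
      nlinarith
  choose ν hν hνim using hνex
  let N : Matrix (Fin k) (Fin k) ℂ := diagonal ν
  let m : Matrix (Fin k) (Fin k) ℂ := diagonal fun j => (√(η j - 2 * z.re) : ℂ)
  have hmH : mᴴ = m := by
    simp only [m, diagonal_conjTranspose]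
    congr 1; ext j; simp
  obtain ⟨Q, hQ⟩ : ∃ Q, Q = V * N := ⟨_, rfl⟩
  have hQQ : Qᴴ * Q = Nᴴ * N := by
    rw [hQ, conjTranspose_mul, Matrix.mul_assoc, ← Matrix.mul_assoc Vᴴ, hV, Matrix.one_mul]
  have hQL : Qᴴ * L = Nᴴ * m := by
    rw [hQ, hLV, conjTranspose_mul, Matrix.mul_assoc, ← Matrix.mul_assoc Vᴴ, hV, Matrix.one_mul]
  have hLQ : Lᴴ * Q = m * N := by
    rw [hQ, hLV, conjTranspose_mul, Matrix.mul_assoc, ← Matrix.mul_assoc Vᴴ, hV, Matrix.one_mul,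
      hmH]
  have hC : C = (2⁻¹ : ℂ) • (K + L) := by rw [hK, hL]; module
  have hD : D = (2⁻¹ : ℂ) • (Kᴴ - Lᴴ) := by
    rw [hK, hL]
    simp only [conjTranspose_add, conjTranspose_sub, conjTranspose_conjTranspose]
    module
  have hKK : Kᴴ * K = diagonal fun j => ((η j + 2 * z.re : ℝ) : ℂ) := by
    have h1 : Kᴴ * K = Cᴴ * C + D * Dᴴ + D * C + Cᴴ * Dᴴ := by
      rw [hK, conjTranspose_add, conjTranspose_conjTranspose]
      simp only [Matrix.mul_add, Matrix.add_mul]; abel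
    rw [h1, hη, hDC, hDC']
    ext i j
    by_cases hij : i = j
    · subst hij
      apply Complex.ext <;> simp
      ring
    · simp [hij]
  have hKL : Kᴴ * L - Lᴴ * K = (4 * z.im * Complex.I) • 1 := by
    have h1 : Kᴴ * L - Lᴴ * K = (2 : ℂ) • (D * C - Cᴴ * Dᴴ) := by
      rw [hK, hL, conjTranspose_add, conjTranspose_sub, conjTranspose_conjTranspose]
      simp only [Matrix.mul_add, Matrix.add_mul, Matrix.mul_sub, Matrix.sub_mul]; module
    rw [h1, hDC, hDC', ← sub_smul, smul_smul]
    congr 1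
    apply Complex.ext <;> simp
    ring
  have ha' : (a : ℂ) ≠ 0 := by exact_mod_cast ha.ne'
  have hdiag : -(4 * a : ℂ)⁻¹ • (Kᴴ * K) + (a : ℂ) • (Nᴴ * N) + b • 1
      + (2⁻¹ : ℂ) • (Nᴴ * m - m * N) - (4 * a : ℂ)⁻¹ • ((4 * z.im * Complex.I) • 1) = 0 := by
    rw [hKK, diagonal_conjTranspose, diagonal_mul_diagonal, diagonal_mul_diagonal,
      diagonal_mul_diagonal]
    ext i j
    by_cases hij : i = j
    · subst hij
      have h1 := hν i
      have h2 := hνim i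
      simp only [Matrix.add_apply, Matrix.sub_apply, Matrix.smul_apply, diagonal_apply_eq,
        one_apply_eq, Pi.star_apply, Matrix.zero_apply, smul_eq_mul]
      rw [h1]
      have h3 : star (ν i) * (√(η i - 2 * z.re) : ℂ) - (√(η i - 2 * z.re) : ℂ) * ν i
          = -2 * ((b.im - z.im / a : ℝ) : ℂ) * Complex.I := by
        rw [← h2]
        apply Complex.ext <;> simp <;> ring
      rw [h3]
      nth_rewrite 2 [← Complex.re_add_im b]
      push_cast
      field_simp
      ring
    · simp [hij]
  refine ⟨-(2 * a : ℂ)⁻¹ • K + Q, ?_⟩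
  have hS : (-(2 * a : ℂ)⁻¹ • K + Q)ᴴ = -(2 * a : ℂ)⁻¹ • Kᴴ + Qᴴ := by
    simp [conjTranspose_smul]
  rw [hS, hC, hD, ← hdiag, ← hKL, ← hQQ, ← hQL, ← hLQ]
  simp only [Matrix.mul_add, Matrix.add_mul, Matrix.sub_mul, Matrix.smul_mul,
    Matrix.mul_smul]
  match_scalars <;> field_simp <;> ring

/-- If `DC` is scalar and `CᴴC + DDᴴ` is diagonal with large enough entries, then the block matrix
with diagonal blocks `a`, `b` and off-diagonal blocks `C`, `D` has an isotropic graph subspace. -/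
theorem exists_quadratic_solution {r k : ℕ} (hkr : k ≤ r) (a b z : ℂ) (ha : a ≠ 0)
    (C : Matrix (Fin r) (Fin k) ℂ) (D : Matrix (Fin k) (Fin r) ℂ) (hDC : D * C = z • 1)
    (η : Fin k → ℝ) (hη : Cᴴ * C + D * Dᴴ = diagonal fun j => (η j : ℂ))
    (hineq : ∀ j, 2 * (a * star b).re + 2 * ‖a * b - z‖ ≤ η j) :
    ∃ S : Matrix (Fin r) (Fin k) ℂ, a • (Sᴴ * S) + b • 1 + Sᴴ * C + D * S = 0 := by
  have hna : (‖a‖ : ℂ) ≠ 0 := by exact_mod_cast norm_ne_zero_iff.2 ha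
  -- Multiplying the equation by this phase makes `a` positive; `z` becomes `u ^ 2 * z`, and the
  -- bound on `η` is unaffected.
  obtain ⟨u, hu⟩ : ∃ u : ℂ, u = star a / ‖a‖ := ⟨_, rfl⟩
  have hua : u * a = ‖a‖ := by
    rw [hu, div_mul_eq_mul_div, Complex.star_def, Complex.conj_mul']
    field_simp
  have hun : ‖u‖ = 1 := by
    have := congrArg norm hua
    rw [norm_mul, Complex.norm_real, norm_norm] at this
    exact mul_right_cancel₀ (norm_ne_zero_iff.2 ha) (by rw [this, one_mul])
  have huu : star u * u = 1 := by
    rw [Complex.star_def, Complex.conj_mul', hun]; simp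
  have hu0 : u ≠ 0 := norm_ne_zero_iff.1 (by rw [hun]; exact one_ne_zero)
  have huu' : u * star u = 1 := by rw [mul_comm, huu]
  obtain ⟨S, hS⟩ := exists_quadratic_solution_of_pos hkr ‖a‖ (norm_pos_iff.2 ha) (u * b)
    (u ^ 2 * z) (u • C) (u • D)
    (by rw [Matrix.smul_mul, Matrix.mul_smul, hDC, smul_smul, smul_smul]; congr 1; ring) η
    (by rw [conjTranspose_smul, conjTranspose_smul, Matrix.smul_mul, Matrix.mul_smul, smul_smul,
          Matrix.smul_mul, Matrix.mul_smul, smul_smul, huu, huu', one_smul, one_smul, hη])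
    (by
      intro j
      have h1 : (‖a‖ : ℂ) * star (u * b) = a * star b := by
        rw [← hua, star_mul]; linear_combination (a * star b) * huu
      have h2 : (‖a‖ : ℂ) * (u * b) - u ^ 2 * z = u ^ 2 * (a * b - z) := by
        rw [← hua]; ring
      rw [h1, h2, norm_mul, norm_pow, hun, one_pow, one_mul]
      exact hineq j)
  refine ⟨S, ?_⟩
  have h3 : u • (a • (Sᴴ * S) + b • 1 + Sᴴ * C + D * S) = 0 := by
    rw [← hS, ← hua]
    simp only [Matrix.smul_mul, Matrix.mul_smul]
    module
  exact (smul_eq_zero.1 h3).resolve_left hu0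

/-! ### Rotated Hermitian parts of the block matrix. -/

theorem star_dotProduct_self_eq_norm_sq {ι : Type*} [Fintype ι] (v : ι → ℂ) :
    star v ⬝ᵥ v = ((‖WithLp.toLp 2 v‖ ^ 2 : ℝ) : ℂ) := by
  rw [dotProduct_comm, ← EuclideanSpace.inner_toLp_toLp, inner_self_eq_norm_sq_to_K]
  simp

theorem norm_star_dotProduct_le {ι : Type*} [Fintype ι] (v w : ι → ℂ) :
    ‖star v ⬝ᵥ w‖ ≤ ‖WithLp.toLp 2 v‖ * ‖WithLp.toLp 2 w‖ := by
  rw [dotProduct_comm, ← EuclideanSpace.inner_toLp_toLp]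
  exact norm_inner_le_norm _ _

/-- There is a unimodular number whose square rotates `w` to the nonnegative real axis. -/
theorem exists_norm_eq_one_sq_mul_eq_norm (w : ℂ) : ∃ e : ℂ, ‖e‖ = 1 ∧ e ^ 2 * w = ‖w‖ := by
  refine ⟨Complex.exp ((-(w.arg / 2) : ℝ) * Complex.I), Complex.norm_exp_ofReal_mul_I _, ?_⟩
  calc _ = Complex.exp ((-(w.arg / 2) : ℝ) * Complex.I) ^ 2
        * (‖w‖ * Complex.exp (w.arg * Complex.I)) := by rw [Complex.norm_mul_exp_arg_mul_I]
    _ = ‖w‖ * Complex.exp (2 * (-((w.arg : ℂ) / 2) * Complex.I) + w.arg * Complex.I) := by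
      rw [← Complex.exp_nat_mul, mul_left_comm, ← Complex.exp_add]
      push_cast
      rfl
    _ = ‖w‖ := by
      rw [show 2 * (-((w.arg : ℂ) / 2) * Complex.I) + w.arg * Complex.I = 0 by ring]
      simp

section BlockForm

variable {r m : ℕ} {α β z : ℂ} {C : Matrix (Fin r) (Fin m) ℂ} {D : Matrix (Fin m) (Fin r) ℂ}

theorem fromBlocks_sub_smul_one (μ : ℂ) :
    fromBlocks (α • 1) C D (β • 1) - μ • 1 = fromBlocks ((α - μ) • 1) C D ((β - μ) • 1) := by
  rw [← fromBlocks_one, fromBlocks_smul, sub_eq_add_neg, fromBlocks_neg, fromBlocks_add]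
  simp [sub_smul, ← sub_eq_add_neg]

theorem star_dotProduct_fromBlocks_mulVec (a b : ℂ) (v : Fin r ⊕ Fin m → ℂ) :
    star v ⬝ᵥ fromBlocks (a • 1) C D (b • 1) *ᵥ v =
      a * ((‖WithLp.toLp 2 (v ∘ Sum.inl)‖ ^ 2 : ℝ) : ℂ)
        + b * ((‖WithLp.toLp 2 (v ∘ Sum.inr)‖ ^ 2 : ℝ) : ℂ)
        + (star (v ∘ Sum.inl) ⬝ᵥ C *ᵥ (v ∘ Sum.inr) + star (v ∘ Sum.inr) ⬝ᵥ D *ᵥ (v ∘ Sum.inl)) := by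
  have hv : star v = Sum.elim (star (v ∘ Sum.inl)) (star (v ∘ Sum.inr)) := by
    ext (i | i) <;> rfl
  rw [fromBlocks_mulVec, hv, sumElim_dotProduct_sumElim, dotProduct_add, dotProduct_add,
    smul_mulVec, smul_mulVec, one_mulVec, one_mulVec, dotProduct_smul, dotProduct_smul,
    star_dotProduct_self_eq_norm_sq, star_dotProduct_self_eq_norm_sq, smul_eq_mul, smul_eq_mul]
  ring

theorem re_mul_add_re_mul_add_re_eq_zero {a b : ℂ} {v : Fin r ⊕ Fin m → ℂ}
    (h : star v ⬝ᵥ fromBlocks (a • 1) C D (b • 1) *ᵥ v = 0) (e : ℂ) :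
    (e * a).re * ‖WithLp.toLp 2 (v ∘ Sum.inl)‖ ^ 2 + (e * b).re * ‖WithLp.toLp 2 (v ∘ Sum.inr)‖ ^ 2
      + (star (v ∘ Sum.inl) ⬝ᵥ (e • C + star e • Dᴴ) *ᵥ (v ∘ Sum.inr)).re = 0 := by
  rw [star_dotProduct_fromBlocks_mulVec] at h
  set s := v ∘ Sum.inl
  set t := v ∘ Sum.inr
  have h1 : star s ⬝ᵥ Dᴴ *ᵥ t = star (star t ⬝ᵥ D *ᵥ s) := by
    rw [← star_dotProduct_star, star_star, star_mulVec, dotProduct_mulVec]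
  rw [add_mulVec, smul_mulVec, smul_mulVec, dotProduct_add, dotProduct_smul, dotProduct_smul, h1]
  have h2 := congrArg (fun x => (e * x).re) h
  simp only [Complex.add_re, Complex.mul_re, Complex.add_im, Complex.mul_im, Complex.ofReal_re,
    Complex.ofReal_im, smul_eq_mul, Complex.star_def, Complex.conj_re, Complex.conj_im, mul_zero,
    Complex.zero_re] at h2 ⊢
  linarith

/-- The cross terms of the Gram matrix are e²DC and its adjoint, hence scalar: the pencil has the
same eigenvectors for every `e`, with all squared singular values shifted equally. -/
theorem norm_sq_pencil_mulVec (hDC : D * C = z • 1) {η : Fin m → ℝ}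
    (hη : Cᴴ * C + D * Dᴴ = diagonal fun j => (η j : ℂ)) {e : ℂ} (he : ‖e‖ = 1) (t : Fin m → ℂ) :
    ‖WithLp.toLp 2 ((e • C + star e • Dᴴ) *ᵥ t)‖ ^ 2 =
      ∑ j, (η j + 2 * (e ^ 2 * z).re) * ‖t j‖ ^ 2 := by
  have hDC' : Cᴴ * Dᴴ = star z • 1 := by
    rw [← conjTranspose_mul, hDC, conjTranspose_smul, conjTranspose_one]
  have hee : star e * e = 1 := by rw [Complex.star_def, Complex.conj_mul', he]; simp
  have hK : (e • C + star e • Dᴴ)ᴴ * (e • C + star e • Dᴴ)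
      = diagonal fun j => ((η j + 2 * (e ^ 2 * z).re : ℝ) : ℂ) := by
    have h1 : (e • C + star e • Dᴴ)ᴴ * (e • C + star e • Dᴴ)
        = (star e * e) • (Cᴴ * C + D * Dᴴ) + (e ^ 2) • (D * C) + (star (e ^ 2)) • (Cᴴ * Dᴴ) := by
      rw [conjTranspose_add, conjTranspose_smul, conjTranspose_smul, conjTranspose_conjTranspose,
        star_star, star_pow]
      simp only [Matrix.mul_add, Matrix.add_mul, Matrix.smul_mul, Matrix.mul_smul]
      module
    rw [h1, hee, one_smul, hη, hDC, hDC', smul_smul, smul_smul, ← star_mul']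
    generalize e ^ 2 = w
    ext i j
    by_cases hij : i = j
    · subst hij
      apply Complex.ext <;> simp <;> ring
    · simp [hij]
  have h2 := star_dotProduct_self_eq_norm_sq ((e • C + star e • Dᴴ) *ᵥ t)
  rw [star_mulVec, ← dotProduct_mulVec, mulVec_mulVec, hK] at h2
  apply Complex.ofReal_injective
  rw [← h2]
  push_cast
  simp only [dotProduct, mulVec_diagonal, Pi.star_apply]
  refine Finset.sum_congr rfl fun j _ => ?_
  rw [← Complex.conj_mul', ← Complex.star_def]
  ring

theorem add_two_mul_re_nonneg (hDC : D * C = z • 1) {η : Fin m → ℝ}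
    (hη : Cᴴ * C + D * Dᴴ = diagonal fun j => (η j : ℂ)) {e : ℂ} (he : ‖e‖ = 1) (j : Fin m) :
    0 ≤ η j + 2 * (e ^ 2 * z).re := by
  have h := norm_sq_pencil_mulVec hDC hη he (Pi.single j 1)
  rw [Finset.sum_eq_single j (fun i _ hij => by simp [hij]) (by simp)] at h
  simp only [Pi.single_eq_same, norm_one, one_pow, mul_one] at h
  rw [← h]
  positivity

/-- Take `e ^ 2 * z = -‖z‖` in the nonnegative Gram eigenvalue. This is what keeps the radicand of
the minor axis nonnegative. -/
theorem two_mul_norm_le (hDC : D * C = z • 1) {η : Fin m → ℝ}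
    (hη : Cᴴ * C + D * Dᴴ = diagonal fun j => (η j : ℂ)) (j : Fin m) : 2 * ‖z‖ ≤ η j := by
  obtain ⟨e, he, hez⟩ := exists_norm_eq_one_sq_mul_eq_norm (-z)
  have := add_two_mul_re_nonneg hDC hη he j
  rw [mul_neg, norm_neg, neg_eq_iff_eq_neg] at hez
  rw [hez] at this
  simp at this
  linarith

theorem eq_zero_of_norm_toLp_comp {v : Fin r ⊕ Fin m → ℂ}
    (h1 : ‖WithLp.toLp 2 (v ∘ Sum.inl)‖ = 0) (h2 : ‖WithLp.toLp 2 (v ∘ Sum.inr)‖ = 0) : v = 0 := by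
  rw [norm_eq_zero, WithLp.toLp_eq_zero] at h1 h2
  ext (i | i)
  · exact congrFun h1 i
  · exact congrFun h2 i

theorem self_mem_higherRankNumericalRange {k : ℕ} (hkr : k ≤ r) :
    α ∈ higherRankNumericalRange k (fromBlocks (α • 1) C D (β • 1)) := by
  rw [mem_higherRankNumericalRange_iff, fromBlocks_sub_smul_one]
  let T : Matrix (Fin r) (Fin k) ℂ := (1 : Matrix (Fin r) (Fin r) ℂ).submatrix id (Fin.castLE hkr)
  have hTT : Tᴴ * T = 1 := by
    rw [conjTranspose_submatrix, conjTranspose_one,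
      ← submatrix_mul _ _ _ id _ Function.bijective_id, Matrix.one_mul,
      submatrix_one _ (Fin.castLE_injective hkr)]
  refine ⟨fromRows T 0, ?_, ?_⟩
  · refine Function.LeftInverse.injective (g := (fromCols Tᴴ 0).mulVec) fun v => ?_
    rw [mulVec_mulVec, fromCols_mul_fromRows, hTT]
    simp
  · rw [Matrix.mul_assoc, fromBlocks_mul_fromRows, conjTranspose_fromRows_eq_fromCols_conjTranspose,
      fromCols_mul_fromRows]
    simp

/-- Compressing the second block to its first `k` coordinates preserves both hypotheses on C and D,
so the graph of a solution S is isotropic. The case `α = μ` is separate because the quadratic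
equation needs a nonzero leading coefficient. -/
theorem mem_higherRankNumericalRange_of_le {k : ℕ} (hkr : k ≤ r) (hkm : k ≤ m) (hDC : D * C = z • 1)
    {η : Fin m → ℝ} (hη : Cᴴ * C + D * Dᴴ = diagonal fun j => (η j : ℂ)) {μ : ℂ}
    (hμ : ∀ j : Fin m, (j : ℕ) < k →
      2 * ((α - μ) * star (β - μ)).re + 2 * ‖(α - μ) * (β - μ) - z‖ ≤ η j) :
    μ ∈ higherRankNumericalRange k (fromBlocks (α • 1) C D (β • 1)) := by
  rcases eq_or_ne α μ with rfl | hne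
  · exact self_mem_higherRankNumericalRange hkr
  rw [mem_higherRankNumericalRange_iff, fromBlocks_sub_smul_one]
  let T : Matrix (Fin m) (Fin k) ℂ := (1 : Matrix (Fin m) (Fin m) ℂ).submatrix id (Fin.castLE hkm)
  have hTT : Tᴴ * T = 1 := by
    rw [conjTranspose_submatrix, conjTranspose_one,
      ← submatrix_mul _ _ _ id _ Function.bijective_id, Matrix.one_mul,
      submatrix_one _ (Fin.castLE_injective hkm)]
  have hTHT : Tᴴ * (Cᴴ * C + D * Dᴴ) * T = diagonal fun j => (η (Fin.castLE hkm j) : ℂ) := by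
    rw [hη, ← submatrix_id_id (diagonal _), conjTranspose_submatrix, conjTranspose_one,
      ← submatrix_mul _ _ _ id _ Function.bijective_id, Matrix.one_mul,
      ← submatrix_mul _ _ _ id _ Function.bijective_id, Matrix.mul_one,
      submatrix_diagonal _ _ (Fin.castLE_injective hkm)]
    rfl
  obtain ⟨S, hS⟩ := exists_quadratic_solution hkr (α - μ) (β - μ) z (sub_ne_zero.2 hne)
    (C * T) (Tᴴ * D)
    (by rw [Matrix.mul_assoc, ← Matrix.mul_assoc D, hDC]; simp [hTT])
    (fun j => η (Fin.castLE hkm j))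
    (by rw [← hTHT]
        simp only [conjTranspose_mul, conjTranspose_conjTranspose, Matrix.mul_add, Matrix.add_mul,
          Matrix.mul_assoc])
    (fun j => hμ _ j.2)
  refine ⟨fromRows S T, ?_, ?_⟩
  · refine Function.LeftInverse.injective (g := (fromCols 0 Tᴴ).mulVec) fun v => ?_
    rw [mulVec_mulVec, fromCols_mul_fromRows, hTT]
    simp
  · rw [Matrix.mul_assoc, fromBlocks_mul_fromRows, conjTranspose_fromRows_eq_fromCols_conjTranspose,
      fromCols_mul_fromRows, ← hS, ← hTT]
    simp only [Matrix.mul_add, Matrix.smul_mul, Matrix.mul_smul, Matrix.one_mul, Matrix.mul_assoc]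
    abel

/-- An isotropic subspace of dimension above `m` contains a nonzero vector supported on the first
block, where the form is (α - μ)‖s‖². -/
theorem eq_left_of_mem_higherRankNumericalRange {k : ℕ} (hmk : m < k) {μ : ℂ}
    (hμ : μ ∈ higherRankNumericalRange k (fromBlocks (α • 1) C D (β • 1))) : μ = α := by
  rw [mem_higherRankNumericalRange_iff, fromBlocks_sub_smul_one] at hμ
  obtain ⟨X, hX, h0⟩ := hμ
  obtain ⟨v, hv, hF, hB⟩ := exists_isotropic_vector _ X hX h0 (LinearMap.funLeft ℂ ℂ Sum.inr)
    (by simpa using hmk)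
  have ht : v ∘ Sum.inr = 0 := hF
  rw [star_dotProduct_fromBlocks_mulVec, ht] at hB
  by_contra hne
  have hs : ‖WithLp.toLp 2 (v ∘ Sum.inl)‖ = 0 := by
    have : α - μ ≠ 0 := sub_ne_zero.2 (Ne.symm hne)
    simpa [this] using hB
  exact hv (eq_zero_of_norm_toLp_comp hs (by simp [ht]))

theorem eq_right_of_mem_higherRankNumericalRange {k : ℕ} (hrk : r < k) {μ : ℂ}
    (hμ : μ ∈ higherRankNumericalRange k (fromBlocks (α • 1) C D (β • 1))) : μ = β := by
  rw [mem_higherRankNumericalRange_iff, fromBlocks_sub_smul_one] at hμ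
  obtain ⟨X, hX, h0⟩ := hμ
  obtain ⟨v, hv, hF, hB⟩ := exists_isotropic_vector _ X hX h0 (LinearMap.funLeft ℂ ℂ Sum.inl)
    (by simpa using hrk)
  have hs : v ∘ Sum.inl = 0 := hF
  rw [star_dotProduct_fromBlocks_mulVec, hs] at hB
  by_contra hne
  have ht : ‖WithLp.toLp 2 (v ∘ Sum.inr)‖ = 0 := by
    have : β - μ ≠ 0 := sub_ne_zero.2 (Ne.symm hne)
    simpa [this] using hB
  exact hv (eq_zero_of_norm_toLp_comp (by simp [hs]) ht)

/-- Membership in the rank-`(j₀ + 1)` numerical range bounds the entry of index `j₀`: otherwise a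
rotation of the shifted matrix has a negative definite real part on too large a subspace. -/
theorem le_of_mem_higherRankNumericalRange (hDC : D * C = z • 1) {η : Fin m → ℝ}
    (hη : Cᴴ * C + D * Dᴴ = diagonal fun j => (η j : ℂ)) (hanti : Antitone η) {μ : ℂ} (j₀ : Fin m)
    (hμ : μ ∈ higherRankNumericalRange (j₀ + 1) (fromBlocks (α • 1) C D (β • 1))) :
    2 * ((α - μ) * star (β - μ)).re + 2 * ‖(α - μ) * (β - μ) - z‖ ≤ η j₀ := by
  rw [mem_higherRankNumericalRange_iff, fromBlocks_sub_smul_one] at hμ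
  obtain ⟨X, hX, h0⟩ := hμ
  set a := α - μ
  set b := β - μ
  by_contra! hlt
  -- Only `e ^ 2` is prescribed, so the sign of `e` is free.
  obtain ⟨e, he, hez, hneg⟩ : ∃ e : ℂ, ‖e‖ = 1 ∧ e ^ 2 * (a * b - z) = ‖a * b - z‖ ∧
      (e * a).re ≤ 0 := by
    obtain ⟨e, he, hez⟩ := exists_norm_eq_one_sq_mul_eq_norm (a * b - z)
    rcases le_total (e * a).re 0 with h | h
    · exact ⟨e, he, hez, h⟩
    · exact ⟨-e, by rwa [norm_neg], by rwa [neg_sq], by simpa using h⟩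
  have hκ0 := add_two_mul_re_nonneg hDC hη he j₀
  set κ := η j₀ + 2 * (e ^ 2 * z).re with hκ
  have hpq : κ < 4 * ((e * a).re * (e * b).re) := by
    have h1 : 4 * ((e * a).re * (e * b).re)
        = 2 * (star e * e * (a * star b)).re + 2 * (e ^ 2 * (a * b)).re := by
      simp [pow_two]; ring
    have h2 : star e * e = 1 := by rw [Complex.star_def, Complex.conj_mul', he]; simp
    have h3 : (e ^ 2 * (a * b)).re = ‖a * b - z‖ + (e ^ 2 * z).re := by
      rw [mul_sub, sub_eq_iff_eq_add] at hez
      rw [hez]; simp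
    rw [h1, h2, one_mul, h3]
    linarith
  set p := (e * a).re
  set q := (e * b).re
  have hp : p < 0 := lt_of_le_of_ne hneg (by rintro h; rw [h] at hpq; linarith)
  have hq : q < 0 := by nlinarith
  -- Killing the first `j₀` coordinates of the second block leaves only Gram eigenvalues at most
  -- `κ`.
  obtain ⟨v, hv, hF, hB⟩ := exists_isotropic_vector _ X hX h0
    (LinearMap.funLeft ℂ ℂ fun i : Fin j₀ => (Sum.inr (Fin.castLE j₀.2.le i) : Fin r ⊕ Fin m))
    (by simp)
  have hre := re_mul_add_re_mul_add_re_eq_zero hB e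
  have hcs := (Complex.abs_re_le_norm _).trans
    (norm_star_dotProduct_le (v ∘ Sum.inl) ((e • C + star e • Dᴴ) *ᵥ (v ∘ Sum.inr)))
  have hK : ‖WithLp.toLp 2 ((e • C + star e • Dᴴ) *ᵥ (v ∘ Sum.inr))‖ ^ 2
      ≤ κ * ‖WithLp.toLp 2 (v ∘ Sum.inr)‖ ^ 2 := by
    rw [norm_sq_pencil_mulVec hDC hη he, EuclideanSpace.norm_sq_eq, Finset.mul_sum]
    refine Finset.sum_le_sum fun j _ => ?_
    rcases lt_or_ge j j₀ with hj | hj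
    · have h0 : v (Sum.inr j) = 0 := congrFun hF ⟨j, hj⟩
      simp [h0]
    · have := hanti hj
      simp only [Function.comp_apply]
      gcongr
      linarith
  have hle := le_of_abs_le hcs
  set x := ‖WithLp.toLp 2 (v ∘ Sum.inl)‖
  set t := ‖WithLp.toLp 2 (v ∘ Sum.inr)‖
  set y := ‖WithLp.toLp 2 ((e • C + star e • Dᴴ) *ᵥ (v ∘ Sum.inr))‖
  have h1 : -p * x ^ 2 - q * t ^ 2 ≤ x * y := by linarith
  -- Multiply `h1` by `-4 * p > 0`, complete the square and use `y ^ 2 ≤ κ * t ^ 2`.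
  have h2 : (-2 * p * x - y) ^ 2 + (4 * (p * q) - κ) * t ^ 2 ≤ 0 := by nlinarith
  have ht : t = 0 := by
    have : (4 * (p * q) - κ) * t ^ 2 ≤ 0 := by nlinarith [sq_nonneg (-2 * p * x - y)]
    have : t ^ 2 ≤ 0 := by nlinarith
    nlinarith
  have hy : y = 0 := by
    rw [ht] at hK; nlinarith
  have hx : x = 0 := by
    rw [ht, hy] at h1
    have : x ^ 2 ≤ 0 := by nlinarith
    nlinarith
  exact hv (eq_zero_of_norm_toLp_comp hx ht)

/-- Membership forces α = μ = β, so the diagonal blocks of A - μ vanish. On the vectors with s =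
-(eC + ēD*)t and t supported on indices up to `j₀`, the Hermitian part is -‖(eC + ēD*)t‖². Choosing
e²z = |z| makes it negative definite there. -/
theorem higherRankNumericalRange_eq_empty {k : ℕ} (hrk : r < k) (hmk : m < k)
    (hDC : D * C = z • 1) {η : Fin m → ℝ}
    (hη : Cᴴ * C + D * Dᴴ = diagonal fun j => (η j : ℂ)) (hanti : Antitone η) (j₀ : Fin m)
    (hj₀ : r + m = k + j₀) (hne : α ≠ β ∨ η j₀ ≠ 0) :
    higherRankNumericalRange k (fromBlocks (α • 1) C D (β • 1)) = ∅ := by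
  rw [Set.eq_empty_iff_forall_notMem]
  intro μ hμ
  have hα := eq_left_of_mem_higherRankNumericalRange hmk hμ
  have hβ := eq_right_of_mem_higherRankNumericalRange hrk hμ
  replace hne := hne.resolve_left (not_not.2 (hα.symm.trans hβ))
  rw [mem_higherRankNumericalRange_iff, fromBlocks_sub_smul_one, ← hα, ← hβ, sub_self] at hμ
  obtain ⟨X, hX, h0⟩ := hμ
  have hpos : ∀ j ≤ j₀, 0 < η j := fun j hj => by
    have h1 := two_mul_norm_le hDC hη j₀
    have h2 : 0 < η j₀ := lt_of_le_of_ne ((by positivity : 0 ≤ 2 * ‖z‖).trans h1) hne.symm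
    exact h2.trans_le (hanti hj)
  obtain ⟨e, he, hez⟩ := exists_norm_eq_one_sq_mul_eq_norm z
  let F : (Fin r ⊕ Fin m → ℂ) →ₗ[ℂ] (Fin r ⊕ {j : Fin m // j₀ < j} → ℂ) :=
    { toFun := fun v => Sum.elim (v ∘ Sum.inl + (e • C + star e • Dᴴ) *ᵥ (v ∘ Sum.inr))
        (fun j => v (Sum.inr j))
      map_add' := fun v w => by
        have : ∀ {κ : Type} (f : κ → Fin r ⊕ Fin m), (v + w) ∘ f = v ∘ f + w ∘ f := fun _ => rfl
        ext (i | j)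
        · simp only [this, mulVec_add, Sum.elim_inl, Pi.add_apply]; ring
        · rfl
      map_smul' := fun c v => by
        have : ∀ {κ : Type} (f : κ → Fin r ⊕ Fin m), (c • v) ∘ f = c • (v ∘ f) := fun _ => rfl
        ext (i | j)
        · simp only [this, mulVec_smul, Sum.elim_inl, Pi.add_apply, Pi.smul_apply, smul_add,
            RingHom.id_apply]
        · rfl }
  -- The number of equations is r + (m - j₀ - 1) = k - 1.
  obtain ⟨v, hv, hF, hB⟩ := exists_isotropic_vector _ X hX h0 F (by
    rw [Fintype.card_sum, Fintype.card_fin, Fintype.card_subtype]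
    have : (Finset.univ.filter fun j => j₀ < j) = Finset.Ioi j₀ := by ext; simp
    rw [this, Fin.card_Ioi]
    omega)
  have hs : v ∘ Sum.inl = -((e • C + star e • Dᴴ) *ᵥ (v ∘ Sum.inr)) := by
    rw [eq_neg_iff_add_eq_zero]
    ext i
    exact congrFun hF (Sum.inl i)
  have hj : ∀ j, j₀ < j → v (Sum.inr j) = 0 := fun j hj => congrFun hF (Sum.inr ⟨j, hj⟩)
  have hre := re_mul_add_re_mul_add_re_eq_zero hB e
  have hK0 : ‖WithLp.toLp 2 ((e • C + star e • Dᴴ) *ᵥ (v ∘ Sum.inr))‖ ^ 2 = 0 := by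
    rw [hs, star_neg, neg_dotProduct, star_dotProduct_self_eq_norm_sq] at hre
    simpa only [mul_zero, Complex.zero_re, zero_mul, zero_add, Complex.neg_re, Complex.ofReal_re,
      neg_eq_zero] using hre
  have hterm : ∀ j, (η j + 2 * (e ^ 2 * z).re) * ‖(v ∘ Sum.inr) j‖ ^ 2 = 0 := by
    rw [norm_sq_pencil_mulVec hDC hη he, Finset.sum_eq_zero_iff_of_nonneg fun j _ =>
      mul_nonneg (add_two_mul_re_nonneg hDC hη he j) (sq_nonneg _)] at hK0
    exact fun j => hK0 j (Finset.mem_univ j)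
  have ht : v ∘ Sum.inr = 0 := by
    ext j
    rcases le_or_gt j j₀ with h | h
    · have h1 := hterm j
      rw [hez, Complex.ofReal_re] at h1
      have h2 : η j + 2 * ‖z‖ ≠ 0 := by have := hpos j h; positivity
      simpa [h2] using h1
    · exact hj j h
  refine hv (eq_zero_of_norm_toLp_comp ?_ (by simp [ht]))
  simp [hs, ht]

end BlockForm

/-! ### The focal description of the ellipse. -/

section Ellipse

variable {α β z Δ δ : ℂ}

/-- Square the sum of distances: the product of the distances is |(α - μ)(β - μ) - z|, and the sum
of their squares is given by the parallelogram law. -/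
theorem norm_sub_add_norm_sub_le_sqrt_iff (hΔ : Δ = (α - β) ^ 2 + 4 * z) (hδ : δ ^ 2 = Δ)
    {h : ℝ} (h0 : 0 ≤ h) (μ : ℂ) :
    ‖μ - ((α + β) / 2 + δ / 2)‖ + ‖μ - ((α + β) / 2 - δ / 2)‖ ≤
        √(‖α - β‖ ^ 2 / 2 + h + ‖Δ‖ / 2) ↔
      2 * ((α - μ) * star (β - μ)).re + 2 * ‖(α - μ) * (β - μ) - z‖ ≤ h := by
  have hprod : ‖μ - ((α + β) / 2 + δ / 2)‖ * ‖μ - ((α + β) / 2 - δ / 2)‖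
      = ‖(α - μ) * (β - μ) - z‖ := by
    rw [← norm_mul]
    congr 1
    linear_combination (-1 / 4 : ℂ) * (hδ.trans hΔ)
  have hsum : ‖μ - ((α + β) / 2 + δ / 2)‖ ^ 2 + ‖μ - ((α + β) / 2 - δ / 2)‖ ^ 2
      = 2 * ((α - μ) * star (β - μ)).re + ‖α - β‖ ^ 2 / 2 + ‖Δ‖ / 2 := by
    rw [← hδ, norm_pow]
    simp only [← Complex.normSq_eq_norm_sq, Complex.normSq_apply, Complex.sub_re, Complex.sub_im,
      Complex.add_re, Complex.add_im, Complex.mul_re, Complex.star_def, Complex.conj_re,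
      Complex.conj_im, Complex.div_ofNat_re, Complex.div_ofNat_im]
    ring
  rw [Real.le_sqrt (by positivity), add_sq, mul_assoc, hprod]
  · constructor <;> intro h1 <;> linarith
  · positivity

theorem isEllipticalDisc_of_forall_mem_iff (hΔ : Δ = (α - β) ^ 2 + 4 * z) (hδ : δ ^ 2 = Δ)
    {h : ℝ} (hz : 2 * ‖z‖ ≤ h) {S : Set ℂ}
    (hS : ∀ μ, μ ∈ S ↔ 2 * ((α - μ) * star (β - μ)).re + 2 * ‖(α - μ) * (β - μ) - z‖ ≤ h) :
    IsEllipticalDisc S ((α + β) / 2 + δ / 2) ((α + β) / 2 - δ / 2)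
      (√(‖α - β‖ ^ 2 / 2 + h + ‖Δ‖ / 2)) (√(‖α - β‖ ^ 2 / 2 + h - ‖Δ‖ / 2)) := by
  have hΔn : ‖Δ‖ ≤ ‖α - β‖ ^ 2 + 4 * ‖z‖ := by
    rw [hΔ]
    refine (norm_add_le _ _).trans_eq ?_
    rw [norm_pow, norm_mul]; simp
  have hΔ0 := norm_nonneg Δ
  have h0 : 0 ≤ h := (by positivity : 0 ≤ 2 * ‖z‖).trans hz
  refine ⟨Real.sqrt_nonneg _, Real.sqrt_nonneg _, ?_, ?_⟩
  · rw [Real.sq_sqrt (by linarith), Real.sq_sqrt (by linarith),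
      show (α + β) / 2 + δ / 2 - ((α + β) / 2 - δ / 2) = δ by ring, ← hδ, norm_pow]
    ring
  · ext μ
    rw [hS, Set.mem_ofPred_eq, norm_sub_add_norm_sub_le_sqrt_iff hΔ hδ h0]

end Ellipse

/-! ### Reduction to the diagonal case and assembly. -/

/-- Unitary changes of basis in the second block do not change the rank-`k` numerical range. -/
theorem higherRankNumericalRange_fromBlocks_conj {r m : ℕ} (α β : ℂ) (C : Matrix (Fin r) (Fin m) ℂ)
    (D : Matrix (Fin m) (Fin r) ℂ) {U : Matrix (Fin m) (Fin m) ℂ} (hU : Uᴴ * U = 1) (k : ℕ) :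
    higherRankNumericalRange k (fromBlocks (α • 1) C D (β • 1)) =
      higherRankNumericalRange k (fromBlocks (α • 1) (C * U) (Uᴴ * D) (β • 1)) := by
  rw [← higherRankNumericalRange_conj k _ (fromBlocks 1 0 0 U : Matrix (Fin r ⊕ Fin m) _ ℂ)]
  · simp [fromBlocks_conjTranspose, fromBlocks_multiply, hU]
  · simp [fromBlocks_conjTranspose, fromBlocks_multiply, hU]

theorem corollary3p1 (n r : ℕ) (hr : 0 < r) (hrn : r < n)
    (α β z₁ : ℂ) (C : Matrix (Fin r) (Fin (n - r)) ℂ) (D : Matrix (Fin (n - r)) (Fin r) ℂ)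
    (A : Matrix (Fin r ⊕ Fin (n - r)) (Fin r ⊕ Fin (n - r)) ℂ)
    (hA : A = Matrix.fromBlocks (α • 1) C D (β • 1))
    (hDC : D * C = z₁ • 1)
    -- `h 1 ≥ ⋯ ≥ h (n - r)` are the eigenvalues of `C*C + DD*`, counting multiplicities
    (h : ℕ → ℝ) (h_anti : AntitoneOn h (Set.Icc 1 (n - r)))
    (h_eig : (C.conjTranspose * C + D * D.conjTranspose).charpoly.roots =
      (Finset.Icc 1 (n - r)).val.map (fun j => (h j : ℂ)))
    -- `δ` is a square root of `Δ`
    (Δ δ : ℂ) (hΔ : Δ = (α - β) ^ 2 + 4 * z₁) (hδ : δ ^ 2 = Δ) :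
    (n < 2 * r →
      (∀ k : ℕ, 1 ≤ k → k ≤ n - r →
        IsEllipticalDisc (higherRankNumericalRange k A)
          ((α + β) / 2 + δ / 2) ((α + β) / 2 - δ / 2)
          (√(‖α - β‖ ^ 2 / 2 + h k + ‖Δ‖ / 2)) (√(‖α - β‖ ^ 2 / 2 + h k - ‖Δ‖ / 2))) ∧
      (∀ k : ℕ, n - r < k → k ≤ r → higherRankNumericalRange k A = {α}) ∧
      (∀ k : ℕ, r < k → k ≤ n → (α ≠ β ∨ h (n - k + 1) ≠ 0) →
        higherRankNumericalRange k A = ∅)) ∧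
    (n = 2 * r →
      (∀ k : ℕ, 1 ≤ k → k ≤ n / 2 →
        IsEllipticalDisc (higherRankNumericalRange k A)
          ((α + β) / 2 + δ / 2) ((α + β) / 2 - δ / 2)
          (√(‖α - β‖ ^ 2 / 2 + h k + ‖Δ‖ / 2)) (√(‖α - β‖ ^ 2 / 2 + h k - ‖Δ‖ / 2))) ∧
      (∀ k : ℕ, n / 2 < k → k ≤ n → (α ≠ β ∨ h (n - k + 1) ≠ 0) →
        higherRankNumericalRange k A = ∅)) := by
  obtain ⟨U, hU, hUH⟩ := exists_unitary_diagonal_of_roots _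
    ((isHermitian_conjTranspose_mul_self C).add (isHermitian_mul_conjTranspose_self D))
    h h_anti h_eig
  have hUU : U * Uᴴ = 1 := mul_eq_one_comm.1 hU
  have hDC' : (Uᴴ * D) * (C * U) = z₁ • 1 := by
    rw [Matrix.mul_assoc, ← Matrix.mul_assoc D, hDC]; simp [hU]
  have hη : (C * U)ᴴ * (C * U) + (Uᴴ * D) * (Uᴴ * D)ᴴ =
      diagonal fun i : Fin (n - r) => (h (i + 1) : ℂ) := by
    rw [← hUH]
    simp only [conjTranspose_mul, conjTranspose_conjTranspose, Matrix.mul_add, Matrix.add_mul,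
      Matrix.mul_assoc]
  have hanti : Antitone fun i : Fin (n - r) => h (i + 1) := fun i j hij =>
    h_anti ⟨by omega, i.2⟩ ⟨by omega, j.2⟩ (by simpa using hij)
  have hdisc : ∀ k : ℕ, 1 ≤ k → k ≤ n - r → k ≤ r →
      IsEllipticalDisc (higherRankNumericalRange k A)
        ((α + β) / 2 + δ / 2) ((α + β) / 2 - δ / 2)
        (√(‖α - β‖ ^ 2 / 2 + h k + ‖Δ‖ / 2)) (√(‖α - β‖ ^ 2 / 2 + h k - ‖Δ‖ / 2)) := by
    intro k hk hkm hkr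
    obtain ⟨k, rfl⟩ := Nat.exists_eq_add_of_le' hk
    apply isEllipticalDisc_of_forall_mem_iff hΔ hδ (two_mul_norm_le hDC' hη ⟨k, hkm⟩)
    intro μ
    rw [hA, higherRankNumericalRange_fromBlocks_conj α β C D hU]
    constructor
    · exact le_of_mem_higherRankNumericalRange hDC' hη hanti ⟨k, hkm⟩
    · intro hμ
      refine mem_higherRankNumericalRange_of_le hkr hkm hDC' hη fun j hj => hμ.trans ?_
      exact hanti (a := j) (b := ⟨k, hkm⟩) (Nat.le_of_lt_succ hj)
  have hempty : ∀ k : ℕ, r < k → n - r < k → k ≤ n → (α ≠ β ∨ h (n - k + 1) ≠ 0) →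
      higherRankNumericalRange k A = ∅ := by
    intro k hrk hmk hkn hne
    rw [hA, higherRankNumericalRange_fromBlocks_conj α β C D hU]
    -- The zero-based index `n - k` corresponds to `h (n - k + 1)`.
    exact higherRankNumericalRange_eq_empty hrk hmk hDC' hη hanti ⟨n - k, by omega⟩
      (by simp only; omega) hne
  refine ⟨fun hn => ⟨fun k hk hkm => hdisc k hk hkm (by omega), fun k hmk hkr => ?_,
    fun k hrk hkn => hempty k hrk (by omega) hkn⟩, fun hn => ⟨fun k hk hkm =>
    hdisc k hk (by omega) (by omega), fun k hk hkn => hempty k (by omega) (by omega) hkn⟩⟩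
  rw [hA]
  exact Set.Subset.antisymm (fun μ hμ => eq_left_of_mem_higherRankNumericalRange hmk hμ)
    (Set.singleton_subset_iff.2 (self_mem_higherRankNumericalRange hkr))
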